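/- Let $GF(4)=\{0,1,\omega,\bar\omega\}$ with $\bar\omega=\omega^2=\omega+1$, conjugation $\bar y=y^2$ and trace $\mathrm{Tr}(x)=x+x^2$. Equip $GF(4)^{n}$ with the trace inner product $x\star y=\sum_j \mathrm{Tr}(x_j\overline{y_j})$; the dual of an additive code $C$ (an additive subgroup of $GF(4)^n$) is $C^\perp=\{x: x\star c=0\ \forall c\in C\}$. Let $\mathrm{wt}$ be the Hamming weight. An even additive self-dual code of length $n$ is extremal if its minimum weight is $2\lfloor n/6\rfloor+2$. Let $S_{18}\subset GF(4)^{18}$ (coordinates $0,\dots,17$) be the $[18,9,8]$ code over $GF(4)$, regarded as an additive $(18,2^{18})$ code, obtained from the cyclic code of length $17$ with generator polynomial $(x^4+x^3+\omega x^2+x+1)(x^4+\omega x^3+x^2+\omega x+1)$ by appending a parity check coordinate. In the secret sharing scheme based on it, the dealer takes a codeword $t$ whose coordinate $t_0$ is the secret, and gives $t_j$ to participant $P_j$, $1\le j\le 17$. Put $a_1=1$, $a_2=\omega$, $a_3=\bar\omega$, and let $H_i$ be the set of $x\in S_{18}^\perp$ with $x_0=a_i$ and $x_j\ne0$ for some $j\ge1$.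 For $x\in H_i$ let $\gamma(x)=\{j\ge 1: x_j\ne 0\}$, and let $\Gamma_{H_i}$ be the family of the sets $\gamma(x)$, $x\in H_i$, where repeated sets are counted with multiplicity. The access structure is $\Gamma=\bigcup_{i\ne j}\Gamma_{H_i}\times\Gamma_{H_j}$, a union of multisets (the multiplicity of a pair is the maximum of its multiplicities in the six families). The accessibility degree of a family $M$ of pairs of subsets of the $m=17$ participants is $|M|/2^{2m}$, counted with multiplicity. A word $a$ is c-covered by $b$ if $a_j=b_j$ whenever $a_j\neq0$. Let $\mu(p,e)$ be the number of codewords of $S_{18}$ of weight $p$ that c-cover $e$, and let $\mu_i(p)$ be the number of words of weight $p$ in $H_i$, i.e. of those that c-cover the weight-one vector with entry $a_i$ at coordinate $0$. A pair $(x,y)\in H_i\times H_j$, $i\neq j$, is minimal if $x$ c-covers no other element of $H_i$ and $y$ c-covers no other element of $H_j$. For a set $A$ of participants and a function $f$ on $GF(4)$, say that $A$ determines $f(t_0)$ if $f(t_0)=f(t_0')$ for all codewords $t,t'$ of $S_{18}$ that agree on $A$; let $\alpha_i(s)=\mathrm{Tr}(s\overline{a_i})$. Then the following hold. 1. $S_{18}$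 is an extremal even additive self-dual code with $2^{18}$ codewords, minimum weight $8$ and weight enumerator $1+2754y^8+18360y^{10}+77112y^{12}+110160y^{14}+50949y^{16}+2808y^{18}$. 2. For $p=8,10,12,14,16,18$ let $N_p=408,\,3400,\,17136,\,28560,\,15096,\,936$, respectively. Then $\mu(p,e)=N_p$ for every vector $e$ of weight $1$, and $\mu_1(p)=\mu_2(p)=\mu_3(p)=N_p$. 3. For all $i\ne j$, the family $\Gamma_{H_i}\times\Gamma_{H_j}$ contains, with multiplicity, exactly $N_pN_q$ pairs of groups of size $(p-1,q-1)$ for $p,q\in\{8,10,12,14,16,18\}$, and no pairs of other sizes; the same holds for $\Gamma$. Explicitly, the numbers of pairs of size $(a,b)$, with rows and columns indexed by $a,b=7,9,11,13,15,17$, are $$\begin{pmatrix}166464&1387200&6991488&11652480&6159168&381888\\1387200&11560000&58262400&97104000&51326400&3182400\\6991488&58262400&293642496&489404160&258685056&16039296\\11652480&97104000&489404160&815673600&431141760&26732160\\6159168&51326400&258685056&431141760&227889216&14129856\\381888&3182400&16039296&26732160&14129856&876096\end{pmatrix}.$$ 4. For $i\ne j$, $x\in H_i$ and $y\in H_j$: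 $\gamma(x)$ determines $\alpha_i(t_0)$, $\gamma(y)$ determines $\alpha_j(t_0)$, and $\gamma(x)\cup\gamma(y)$ determines the secret $t_0$. 5. Every pair $(x,y)\in H_i\times H_j$, $i\neq j$, with $|\gamma(x)|,|\gamma(y)|\in\{7,9,11,13\}$ is minimal. 6. No group of size less than $7$ can be used in recovering the secret: both groups of every pair in $\Gamma$ have size at least $7$, and a set of fewer than $7$ participants determines neither the secret $t_0$ nor any of $\alpha_1(t_0),\alpha_2(t_0),\alpha_3(t_0)$. 7. The accessibility degree of $\Gamma$, and of each $\Gamma_{H_i}\times\Gamma_{H_j}$ with $i\ne j$, is $1/4$. -/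

import Mathlib

open Finset

namespace AdditiveSSS

noncomputable section

/-! Throughout, `F` is a field with four elements and `ω` is an element with `ω ^ 2 + ω + 1 = 0`,
so that `F = {0, 1, ω, ω ^ 2}`, and conjugation on `F` is `y ↦ y ^ 2`. -/

variable {F : Type*} [Field F] [Fintype F] [DecidableEq F] {n : ℕ}

/-- The trace map `x + x ^ 2` (its values lie in the prime field `{0, 1}`). -/
def tr (x : F) : F := x + x ^ 2

/-- The trace inner product of two vectors over the field with four elements. -/
def traceInner (x y : Fin n → F) : F := ∑ i, tr (x i * y i ^ 2)

/-- The dual of an additive code with respect to the trace inner product. -/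
def traceDual (C : AddSubgroup (Fin n → F)) : Set (Fin n → F) :=
  {x | ∀ c ∈ C, traceInner x c = 0}

/-- The additive code equals its trace dual. -/
def IsSelfDual (C : AddSubgroup (Fin n → F)) : Prop :=
  traceDual C = (C : Set (Fin n → F))

/-- All codewords have even Hamming weight. -/
def IsEven (C : AddSubgroup (Fin n → F)) : Prop :=
  ∀ c ∈ C, Even (hammingNorm c)

/-- The smallest weight of a nonzero codeword is `d`. -/
def HasMinWeight (C : AddSubgroup (Fin n → F)) (d : ℕ) : Prop :=
  IsLeast {w | ∃ c ∈ C, c ≠ 0 ∧ hammingNorm c = w} d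

/-- An extremal even additive self-dual code of length `n`: the minimum weight attains the
bound `2 * ⌊n / 6⌋ + 2`. -/
def IsExtremalEvenSelfDual (C : AddSubgroup (Fin n → F)) : Prop :=
  IsSelfDual C ∧ IsEven C ∧ HasMinWeight C (2 * (n / 6) + 2)

open Classical in
/-- The number of codewords of weight `w`. -/
def weightCount (C : AddSubgroup (Fin n → F)) (w : ℕ) : ℕ :=
  #{c : Fin n → F | c ∈ C ∧ hammingNorm c = w}

/-- `a` is componentwise covered by `b`: each nonzero component of `a` equals the corresponding
component of `b`. -/
def CCovered (a b : Fin n → F) : Prop := ∀ j, a j ≠ 0 → a j = b j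

open Classical in
/-- `μ(p, e)`: the number of codewords of weight `p` that c-cover `e`. -/
def mu (C : AddSubgroup (Fin n → F)) (p : ℕ) (e : Fin n → F) : ℕ :=
  #{c : Fin n → F | c ∈ C ∧ hammingNorm c = p ∧ CCovered e c}

/-- The nonzero field elements `1, ω, ω ^ 2`, indexed by `0, 1, 2`. -/
def scal (ω : F) : Fin 3 → F := ![1, ω, ω ^ 2]

/-! ### The secret sharing scheme

Coordinate `0` belongs to the dealer, the other coordinates to the participants. The dealer picks
a codeword `t` whose coordinate `t 0` is the secret and gives `t j` to participant `j`. -/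

section Scheme

variable [NeZero n]

open Classical in
/-- `H_i`: the words of the dual code with first coordinate `1`, `ω`, `ω ^ 2` respectively that
have some further nonzero coordinate. -/
def H (ω : F) (C : AddSubgroup (Fin n → F)) (i : Fin 3) : Finset (Fin n → F) :=
  {x | x ∈ traceDual C ∧ x 0 = scal ω i ∧ ∃ j, j ≠ 0 ∧ x j ≠ 0}

/-- The group of participants attached to a word: its support without the dealer's coordinate. -/
def group (x : Fin n → F) : Finset (Fin n) := ({j | x j ≠ 0} : Finset (Fin n)).erase 0

/-- `Γ_{H_i}`: the supports, without the dealer, of the words of `H_i`. Several words may have the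
same support, so this is a family with repeated blocks. -/
def GammaH (ω : F) (C : AddSubgroup (Fin n → F)) (i : Fin 3) : Multiset (Finset (Fin n)) :=
  (H ω C i).val.map group

/-- The access structure `Γ`: all pairs from `Γ_{H_i} × Γ_{H_j}` with `i ≠ j`, as the union
of these six families with repeated blocks (multiplicities as in a union of multisets,
that is, the maximum of the multiplicities). -/
def Gamma (ω : F) (C : AddSubgroup (Fin n → F)) : Multiset (Finset (Fin n) × Finset (Fin n)) :=
  ({ij | ij.1 ≠ ij.2} : Finset (Fin 3 × Fin 3)).sup
    fun ij => GammaH ω C ij.1 ×ˢ GammaH ω C ij.2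

open Classical in
/-- `μ_i(p, e)`: the number of words of `H_i` of weight `p` that c-cover `e`. -/
def muI (ω : F) (C : AddSubgroup (Fin n → F)) (i : Fin 3) (p : ℕ) (e : Fin n → F) : ℕ :=
  #{x ∈ H ω C i | hammingNorm x = p ∧ CCovered e x}

/-- The minimal access structure. A pair `(x, y) ∈ H_i × H_j`, `i ≠ j`, is minimal if `x` c-covers
no other element of `H_i` and `y` c-covers no other element of `H_j`. -/
def minimalAccessStructure (ω : F) (C : AddSubgroup (Fin n → F)) :
    Set ((Fin n → F) × (Fin n → F)) :=
  {s | ∃ i j, i ≠ j ∧ s.1 ∈ H ω C i ∧ s.2 ∈ H ω C j ∧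
    (∀ x ∈ H ω C i, CCovered x s.1 → x = s.1) ∧ (∀ y ∈ H ω C j, CCovered y s.2 → y = s.2)}

/-- `α_i(s) = tr (s * conj a_i)` with `a_i = 1, ω, ω ^ 2`: two of these three values determine the
secret `s`. -/
def alpha (ω : F) (i : Fin 3) (s : F) : F := tr (s * scal ω i ^ 2)

/-- The shares of the participants in `A` determine the value `f s` of the secret `s`. -/
def Determines (C : AddSubgroup (Fin n → F)) (A : Finset (Fin n)) (f : F → F) : Prop :=
  ∀ t ∈ C, ∀ t' ∈ C, (∀ j ∈ A, t j = t' j) → f (t 0) = f (t' 0)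

end Scheme

/-- The number of pairs of groups of size `(a, b)` in a family of pairs. -/
def sizeCount (M : Multiset (Finset (Fin n) × Finset (Fin n))) (a b : ℕ) : ℕ :=
  M.countP fun s => s.1.card = a ∧ s.2.card = b

/-- The accessibility degree `|Γ| / 2 ^ (2 * m)` of a two-step access structure on the `m = n - 1`
participants. -/
def accessibilityDegree (M : Multiset (Finset (Fin n) × Finset (Fin n))) : ℝ :=
  (Multiset.card M : ℝ) / 2 ^ (2 * (n - 1))

/-! ### The code `S_18` -/

/-- Generator matrix over the field with four elements of the `[18, 9, 8]` code `S_18`: the cyclic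
code of length `17` with generator polynomial
`(x⁴ + x³ + ω x² + x + 1) (x⁴ + ω x³ + x² + ω x + 1)`, extended by a parity check. Here `w`, `v`
stand for `ω`, `ω ^ 2`. -/
def S18Matrix (w v : F) : Matrix (Fin 9) (Fin 18) F :=
  !![1, v, 1, 1, w, 1, 1, v, 1, 0, 0, 0, 0, 0, 0, 0, 0, w;
     0, 1, v, 1, 1, w, 1, 1, v, 1, 0, 0, 0, 0, 0, 0, 0, w;
     0, 0, 1, v, 1, 1, w, 1, 1, v, 1, 0, 0, 0, 0, 0, 0, w;
     0, 0, 0, 1, v, 1, 1, w, 1, 1, v, 1, 0, 0, 0, 0, 0, w;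
     0, 0, 0, 0, 1, v, 1, 1, w, 1, 1, v, 1, 0, 0, 0, 0, w;
     0, 0, 0, 0, 0, 1, v, 1, 1, w, 1, 1, v, 1, 0, 0, 0, w;
     0, 0, 0, 0, 0, 0, 1, v, 1, 1, w, 1, 1, v, 1, 0, 0, w;
     0, 0, 0, 0, 0, 0, 0, 1, v, 1, 1, w, 1, 1, v, 1, 0, w;
     0, 0, 0, 0, 0, 0, 0, 0, 1, v, 1, 1, w, 1, 1, v, 1, w]

/-- The code `S_18`, regarded as an additive code. -/
def S18 (ω : F) : AddSubgroup (Fin 18 → F) :=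
  (Submodule.span F (Set.range (S18Matrix ω (ω ^ 2)).row)).toAddSubgroup

/-- The size distribution: the entry `(k, l)` is the coefficient of `y ^ (7 + 2 k, 7 + 2 l)`. -/
def S18Sizes : Matrix (Fin 6) (Fin 6) ℕ :=
  !![166464, 1387200, 6991488, 11652480, 6159168, 381888;
     1387200, 11560000, 58262400, 97104000, 51326400, 3182400;
     6991488, 58262400, 293642496, 489404160, 258685056, 16039296;
     11652480, 97104000, 489404160, 815673600, 431141760, 26732160;
     6159168, 51326400, 258685056, 431141760, 227889216, 14129856;
     381888, 3182400, 16039296, 26732160, 14129856, 876096]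

/-- The family of pairs of groups has exactly the size distribution `S18Sizes`. -/
def HasS18Sizes (M : Multiset (Finset (Fin 18) × Finset (Fin 18))) : Prop :=
  (∀ k l : Fin 6, sizeCount M (7 + 2 * k) (7 + 2 * l) = S18Sizes k l) ∧
  ∀ s ∈ M, ∃ k l : Fin 6, s.1.card = 7 + 2 * k ∧ s.2.card = 7 + 2 * l

end

end AdditiveSSS

/-! The code $S_{18}$ is linear over $GF(4)$, and everything follows from two facts: it is Hermitian
self-dual with even weights, and its minimum weight is $8$.

The rows of the generator matrix are Hermitian orthogonal and the code has two complementary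
information sets, the coordinates $0,\dots,8$ and $9,\dots,17$; this gives self-duality
(`S18_selfDual`). For linear codes the trace dual is the Hermitian dual. Since $x\bar x=x^3=1$ for
$x\ne0$, the Hermitian norm of a word is its weight mod $2$, so weights are even (`S18_even`). A
nonzero word of weight below $8$ therefore has weight at most $6$, hence at most $3$ nonzero entries
on the left half or at most $2$ on the right half. A finite check of combinations of at most three,
respectively two, rows of the two systematic matrices excludes it (`le_hammingNorm_of_mem_S18`).

By self-duality the dual distance is also $8$, so the code is an orthogonal array of strength $7$:
any prescribed values on at most $7$ coordinates are taken by equally many codewords. Double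
counting of zeros turns this into binomial moments (`sum_choose_zeros`). The only possible nonzero
weights are $8,10,\dots,18$, so six moments determine the six counts (`mu_S18`, `weightCount_S18`).

For the scheme, multiplication by $a_i$ maps $H_1$ onto $H_i$ and preserves supports, so the three
families $\Gamma_{H_i}$ coincide and $\Gamma$ is just one product (`Gamma_eq`). Each family has
$2^{18}/4=2^{16}$ members, whence the degree $2^{32}/2^{34}$. Recovery is orthogonality to a word of
$H_i$, minimality is additivity of weight on disjoint supports, and the failure of small groups is
strength $7$. -/

namespace AdditiveSSS

/-! ### A computable model of the field with four elements -/

/-- The field with four elements; `w` and `v` stand for `ω` and `ω ^ 2`. -/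
inductive GF4 : Type
  | zero | one | w | v
  deriving DecidableEq

namespace GF4

instance : Fintype GF4 := ⟨{zero, one, w, v}, by rintro (_ | _ | _ | _) <;> decide⟩

/-- Addition table. -/
def add : GF4 → GF4 → GF4
  | zero, y => y
  | x, zero => x
  | one, one => zero
  | one, w => v
  | one, v => w
  | w, one => v
  | w, w => zero
  | w, v => one
  | v, one => w
  | v, w => one
  | v, v => zero

/-- Multiplication table. -/
def mul : GF4 → GF4 → GF4
  | zero, _ => zero
  | _, zero => zero
  | one, y => y
  | x, one => x
  | w, w => v
  | w, v => one
  | v, w => one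
  | v, v => w

instance : Zero GF4 := ⟨zero⟩
instance : One GF4 := ⟨one⟩
instance : Add GF4 := ⟨add⟩
instance : Mul GF4 := ⟨mul⟩
instance : Neg GF4 := ⟨id⟩

instance : CommRing GF4 where
  nsmul := nsmulRec
  zsmul := zsmulRec
  add_assoc := by decide
  zero_add := by decide
  add_zero := by decide
  add_comm := by decide
  neg_add_cancel := by decide
  mul_assoc := by decide
  mul_comm := by decide
  one_mul := by decide
  mul_one := by decide
  left_distrib := by decide
  right_distrib := by decide
  zero_mul := by decide
  mul_zero := by decide

end GF4

/-! ### Codewords of small weight on an information set -/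

/-- The vector of length `m` whose first entries are those of a list, followed by zeros. -/
def listVec (m : ℕ) (l : List GF4) : Fin m → GF4 := fun j => l.getD j 0

/-- The list of the entries of a vector. -/
def vecList : {m : ℕ} → (Fin m → GF4) → List GF4
  | 0, _ => []
  | _ + 1, f => f 0 :: vecList (Fin.tail f)

/-- Addition of lists, padded with zeros. -/
def listAdd : List GF4 → List GF4 → List GF4
  | [], l => l
  | a :: l, [] => a :: l
  | a :: l, b :: l' => GF4.add a b :: listAdd l l'

/-- The number of nonzero entries of a list. -/
def listWeight : List GF4 → ℕ
  | [] => 0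
  | GF4.zero :: l => listWeight l
  | _ :: l => (listWeight l).succ

theorem listVec_vecList {m : ℕ} (f : Fin m → GF4) : listVec m (vecList f) = f := by
  induction m with
  | zero => exact Subsingleton.elim _ _
  | succ m ih =>
    funext j
    refine Fin.cases rfl (fun j => ?_) j
    exact congrFun (ih (Fin.tail f)) j

theorem length_vecList {m : ℕ} (f : Fin m → GF4) : (vecList f).length = m := by
  induction m with
  | zero => rfl
  | succ m ih => simp [vecList, ih]

theorem listVec_listAdd (m : ℕ) (l l' : List GF4) :
    listVec m (listAdd l l') = listVec m l + listVec m l' := by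
  funext ⟨j, hj⟩
  simp only [listVec, Pi.add_apply]
  clear hj
  induction l generalizing l' j with
  | nil => simp [listAdd]
  | cons a l ih =>
    cases l' with
    | nil => simp [listAdd]
    | cons b l' =>
      cases j with
      | zero => rfl
      | succ j => simpa [listAdd] using ih l' j

theorem length_listAdd (l l' : List GF4) :
    (listAdd l l').length = max l.length l'.length := by
  induction l generalizing l' with
  | nil => simp [listAdd]
  | cons a l ih =>
    cases l' with
    | nil => simp [listAdd]
    | cons b l' => simp [listAdd, ih]

theorem hammingNorm_succ {K : Type*} [Zero K] [DecidableEq K] {m : ℕ} (f : Fin (m + 1) → K) :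
    hammingNorm f = (if f 0 ≠ 0 then 1 else 0) + hammingNorm (Fin.tail f) := by
  simp only [hammingNorm, Fin.card_filter_univ_succ]
  split_ifs <;> simp [Fin.tail, Nat.add_comm] <;> rfl

theorem listWeight_eq {m : ℕ} (l : List GF4) (hl : l.length = m) :
    listWeight l = hammingNorm (listVec m l) := by
  induction m generalizing l with
  | zero => simp [List.length_eq_zero_iff.1 hl, listWeight, hammingNorm]
  | succ m ih =>
    obtain ⟨a, l, rfl⟩ := List.exists_cons_of_length_eq_add_one hl
    have h := ih l (by simpa using hl)
    rw [hammingNorm_succ, show Fin.tail (listVec (m + 1) (a :: l)) = listVec m l from rfl, ← h,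
      show listVec (m + 1) (a :: l) 0 = a from rfl]
    cases a
    · simp [listWeight, show GF4.zero = 0 from rfl]
    · simp [listWeight, show GF4.one ≠ 0 by decide, Nat.add_comm]
    · simp [listWeight, show GF4.w ≠ 0 by decide, Nat.add_comm]
    · simp [listWeight, show GF4.v ≠ 0 by decide, Nat.add_comm]

/-- Every combination of the rows `r 0, …, r (k - 1)` with at most `b` nonzero coefficients, added
to `x`, is zero or has weight at least `8`. -/
def checkCombinations {m : ℕ} : (k : ℕ) → (Fin k → Fin m → GF4) → ℕ → List GF4 → Bool
  | 0, _, _, x => Nat.beq (listWeight x) 0 || Nat.ble 8 (listWeight x)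
  | k + 1, r, 0, x => checkCombinations k (Fin.tail r) 0 x
  | k + 1, r, b + 1, x =>
      checkCombinations k (Fin.tail r) (b + 1) x &&
      checkCombinations k (Fin.tail r) b (listAdd x (vecList (r 0))) &&
      checkCombinations k (Fin.tail r) b (listAdd x (vecList (GF4.w • r 0))) &&
      checkCombinations k (Fin.tail r) b (listAdd x (vecList (GF4.v • r 0)))

/-- Induction on the rows: a zero coefficient leaves the budget `b` unchanged, each of the three
nonzero coefficients uses up one unit of it. -/
theorem checkCombinations_sound {m : ℕ} (k : ℕ) (r : Fin k → Fin m → GF4) (b : ℕ)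
    (x : List GF4) (hx : x.length = m) (h : checkCombinations k r b x = true) (a : Fin k → GF4)
    (ha : hammingNorm a ≤ b) :
    listVec m x + ∑ i, a i • r i = 0 ∨ 8 ≤ hammingNorm (listVec m x + ∑ i, a i • r i) := by
  induction k generalizing b x with
  | zero => simpa [checkCombinations, listWeight_eq x hx] using h
  | succ k ih =>
    have hnorm := hammingNorm_succ a
    rw [Fin.sum_univ_succ, ← add_assoc]
    cases b with
    | zero =>
      have h0 : a 0 = 0 := by
        by_contra h0
        simp [h0] at hnorm
        omega
      rw [h0, zero_smul, add_zero]
      exact ih (Fin.tail r) 0 x hx (by simpa [checkCombinations] using h) (Fin.tail a) (by omega)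
    | succ b =>
      simp only [checkCombinations, Bool.and_eq_true] at h
      obtain ⟨⟨⟨h1, h2⟩, h3⟩, h4⟩ := h
      have key (f : Fin m → GF4) (h : checkCombinations k (Fin.tail r) b (listAdd x (vecList f)))
          (h0 : a 0 ≠ 0) := by
        have := ih (Fin.tail r) b (listAdd x (vecList f))
          (by simp [length_listAdd, length_vecList, hx]) h (Fin.tail a)
          (by simp [h0] at hnorm; omega)
        rwa [listVec_listAdd, listVec_vecList] at this
      rcases hc : a 0 with _ | _ | _ | _
      · rw [show GF4.zero = 0 from rfl, zero_smul, add_zero]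
        exact ih (Fin.tail r) _ x hx h1 (Fin.tail a) (by omega)
      · rw [show GF4.one = 1 from rfl, one_smul]
        exact key _ h2 (by simp [hc, show GF4.one ≠ 0 by decide])
      · exact key _ h3 (by simp [hc, show GF4.w ≠ 0 by decide])
      · exact key _ h4 (by simp [hc, show GF4.v ≠ 0 by decide])

/-- Every combination of the rows `r 0, …, r (k - 1)` with at most `b + 1` nonzero coefficients, the
first of which is `1`, is zero or has weight at least `8`. -/
def checkMonic {m : ℕ} : (k : ℕ) → (Fin k → Fin m → GF4) → ℕ → Bool
  | 0, _, _ => true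
  | k + 1, r, b =>
      checkMonic k (Fin.tail r) b && checkCombinations k (Fin.tail r) b (vecList (r 0))

/-- Scaling by a unit preserves weight, so the first nonzero coefficient may be normalised to $1$;
this cuts the search by a factor of three. -/
theorem checkMonic_sound {m : ℕ} (k : ℕ) (r : Fin k → Fin m → GF4) (b : ℕ)
    (h : checkMonic k r b = true) (a : Fin k → GF4) (ha : hammingNorm a ≤ b + 1) :
    ∑ i, a i • r i = 0 ∨ 8 ≤ hammingNorm (∑ i, a i • r i) := by
  induction k with
  | zero => simp
  | succ k ih =>
    simp only [checkMonic, Bool.and_eq_true] at h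
    have hnorm := hammingNorm_succ a
    by_cases h0 : a 0 = 0
    · rw [Fin.sum_univ_succ, h0, zero_smul, zero_add]
      exact ih (Fin.tail r) h.1 (Fin.tail a) (by omega)
    -- The model carries only a ring structure; the inverse of a nonzero `u` is written `u ^ 2`, as
    -- $u^3=1$.
    · have hinv : ∀ u : GF4, u ≠ 0 → u * u ^ 2 = 1 := by decide
      have hreg (u : GF4) (hu : u ≠ 0) : IsSMulRegular GF4 u := by
        intro x y hxy
        have := congrArg (u ^ 2 * ·) hxy
        simpa [← mul_assoc, mul_comm (u ^ 2) u, hinv u hu] using this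
      have hsq : ∀ u : GF4, u ≠ 0 → u ^ 2 ≠ 0 := by decide
      have key := checkCombinations_sound k (Fin.tail r) b _ (length_vecList (r 0)) h.2
        (a 0 ^ 2 • Fin.tail a) (by
          rw [hammingNorm_smul fun _ => hreg _ (hsq _ h0)]
          simp [h0] at hnorm
          omega)
      have hsum : ∑ i, a i • r i =
          a 0 • (listVec m (vecList (r 0)) + ∑ i, (a 0 ^ 2 • Fin.tail a) i • Fin.tail r i) := by
        rw [listVec_vecList, Fin.sum_univ_succ, smul_add, Finset.smul_sum]
        congr 1
        refine Finset.sum_congr rfl fun i _ => ?_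
        rw [Pi.smul_apply, smul_assoc, smul_smul, hinv _ h0, one_smul]
        rfl
      rw [hsum, hammingNorm_smul fun _ => hreg _ h0]
      refine key.imp (fun h => by rw [h, smul_zero]) id

/-! ### Systematic generator matrices of `S_18` -/

section Matrices

open GF4

/-- The generator matrix of `S_18` that is systematic on the coordinates `0, …, 8`. -/
def leftMatrix : Matrix (Fin 9) (Fin 18) GF4 :=
  !![1, 0, 0, 0, 0, 0, 0, 0, 0, 1, v, 1, 1, w, 1, 1, v, w;
     0, 1, 0, 0, 0, 0, 0, 0, 0, v, v, 0, w, 0, 1, w, v, v;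
     0, 0, 1, 0, 0, 0, 0, 0, 0, v, 1, 0, v, v, v, w, 0, w;
     0, 0, 0, 1, 0, 0, 0, 0, 0, 0, v, 1, 0, v, v, v, w, w;
     0, 0, 0, 0, 1, 0, 0, 0, 0, w, 1, 1, v, v, 1, 1, w, 1;
     0, 0, 0, 0, 0, 1, 0, 0, 0, w, v, v, v, 0, 1, v, 0, w;
     0, 0, 0, 0, 0, 0, 1, 0, 0, 0, w, v, v, v, 0, 1, v, w;
     0, 0, 0, 0, 0, 0, 0, 1, 0, v, w, 1, 0, w, 0, v, v, v;
     0, 0, 0, 0, 0, 0, 0, 0, 1, v, 1, 1, w, 1, 1, v, 1, w]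

/-- The generator matrix of `S_18` that is systematic on the coordinates `9, …, 17`. -/
def rightMatrix : Matrix (Fin 9) (Fin 18) GF4 :=
  !![1, w, w, 0, v, v, 0, w, w, 1, 0, 0, 0, 0, 0, 0, 0, 0;
     w, w, 1, w, 1, w, v, v, 1, 0, 1, 0, 0, 0, 0, 0, 0, 0;
     1, 0, 0, 1, 1, w, w, 1, 1, 0, 0, 1, 0, 0, 0, 0, 0, 0;
     1, v, w, 0, w, w, w, 0, v, 0, 0, 0, 1, 0, 0, 0, 0, 0;
     v, 0, w, w, w, 0, w, v, 1, 0, 0, 0, 0, 1, 0, 0, 0, 0;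
     1, 1, w, w, 1, 1, 0, 0, 1, 0, 0, 0, 0, 0, 1, 0, 0, 0;
     1, v, v, w, 1, w, 1, w, w, 0, 0, 0, 0, 0, 0, 1, 0, 0;
     w, w, 0, v, v, 0, w, w, 1, 0, 0, 0, 0, 0, 0, 0, 1, 0;
     v, w, v, v, 1, v, v, w, v, 0, 0, 0, 0, 0, 0, 0, 0, 1]

/-- `leftMatrix` in terms of `S18Matrix`. -/
def leftChange : Matrix (Fin 9) (Fin 9) GF4 :=
  !![1, v, v, 0, w, w, 0, v, v;
     0, 1, v, v, 0, w, w, 0, v;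
     0, 0, 1, v, v, 0, w, w, 0;
     0, 0, 0, 1, v, v, 0, w, w;
     0, 0, 0, 0, 1, v, v, 0, w;
     0, 0, 0, 0, 0, 1, v, v, 0;
     0, 0, 0, 0, 0, 0, 1, v, v;
     0, 0, 0, 0, 0, 0, 0, 1, v;
     0, 0, 0, 0, 0, 0, 0, 0, 1]

/-- `rightMatrix` in terms of `S18Matrix`. -/
def rightChange : Matrix (Fin 9) (Fin 9) GF4 :=
  !![1, 1, 0, 0, 0, 0, 0, 0, 0;
     w, v, 1, 0, 0, 0, 0, 0, 0;
     1, v, v, 1, 0, 0, 0, 0, 0;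
     1, 0, v, v, 1, 0, 0, 0, 0;
     v, w, 0, v, v, 1, 0, 0, 0;
     1, w, w, 0, v, v, 1, 0, 0;
     1, 0, w, w, 0, v, v, 1, 0;
     w, v, 0, w, w, 0, v, v, 1;
     v, 0, 0, 0, 0, 0, 0, 0, 0]

/-- `S18Matrix` with entries in the model `GF4`. -/
def modelMatrix : Matrix (Fin 9) (Fin 18) GF4 :=
  !![1, v, 1, 1, w, 1, 1, v, 1, 0, 0, 0, 0, 0, 0, 0, 0, w;
     0, 1, v, 1, 1, w, 1, 1, v, 1, 0, 0, 0, 0, 0, 0, 0, w;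
     0, 0, 1, v, 1, 1, w, 1, 1, v, 1, 0, 0, 0, 0, 0, 0, w;
     0, 0, 0, 1, v, 1, 1, w, 1, 1, v, 1, 0, 0, 0, 0, 0, w;
     0, 0, 0, 0, 1, v, 1, 1, w, 1, 1, v, 1, 0, 0, 0, 0, w;
     0, 0, 0, 0, 0, 1, v, 1, 1, w, 1, 1, v, 1, 0, 0, 0, w;
     0, 0, 0, 0, 0, 0, 1, v, 1, 1, w, 1, 1, v, 1, 0, 0, w;
     0, 0, 0, 0, 0, 0, 0, 1, v, 1, 1, w, 1, 1, v, 1, 0, w;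
     0, 0, 0, 0, 0, 0, 0, 0, 1, v, 1, 1, w, 1, 1, v, 1, w]

/-- This puts the rows of `leftMatrix` into the code. The converse inclusion is
`modelMatrix_eq_left`, whose coefficients are the left columns of `modelMatrix` because `leftMatrix`
is the identity there. -/
theorem leftChange_mul : leftChange * modelMatrix = leftMatrix := by
  decide +kernel

theorem rightChange_mul : rightChange * modelMatrix = rightMatrix := by
  decide +kernel

theorem modelMatrix_eq_left :
    modelMatrix = modelMatrix.submatrix id (Fin.castAdd 9) * leftMatrix := by
  decide +kernel

theorem modelMatrix_eq_right :
    modelMatrix = modelMatrix.submatrix id (Fin.natAdd 9 : Fin 9 → Fin 18) * rightMatrix := by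
  decide +kernel

theorem leftMatrix_submatrix : leftMatrix.submatrix id (Fin.castAdd 9) = 1 := by
  decide +kernel

theorem rightMatrix_submatrix : rightMatrix.submatrix id (Fin.natAdd 9 : Fin 9 → Fin 18) = 1 := by
  decide +kernel

theorem modelMatrix_hermitian :
    modelMatrix * (modelMatrix.map (· ^ 2)).transpose = 0 := by
  decide +kernel

/-- The leading row is not counted in the last argument, so `2` means at most three rows here, and
`1` means at most two rows in `checkMonic_right`. -/
theorem checkMonic_left : checkMonic 9 leftMatrix 2 = true := by
  decide +kernel

theorem checkMonic_right : checkMonic 9 rightMatrix 1 = true := by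
  decide +kernel

end Matrices

/-! ### The code over `F`: self-duality, evenness and minimum weight -/

section Code

theorem hammingNorm_add (m n : ℕ) {K : Type*} [Zero K] [DecidableEq K] (f : Fin (m + n) → K) :
    hammingNorm f = hammingNorm (f ∘ Fin.castAdd n) + hammingNorm (f ∘ Fin.natAdd m) := by
  simp only [hammingNorm, Finset.card_filter, Fin.sum_univ_add, Function.comp]

variable {F : Type*} [Field F]

theorem tr_zero : tr (0 : F) = 0 := by simp [tr]

theorem smul_mem_S18 {ω : F} {c : Fin 18 → F} (hc : c ∈ S18 ω) (a : F) : a • c ∈ S18 ω :=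
  (Submodule.span F (Set.range (S18Matrix ω (ω ^ 2)).row)).smul_mem a hc

open Matrix in
theorem mem_S18_iff (ω : F) (c : Fin 18 → F) :
    c ∈ S18 ω ↔ ∃ a : Fin 9 → F, a ᵥ* S18Matrix ω (ω ^ 2) = c := by
  change c ∈ Submodule.span F (Set.range (S18Matrix ω (ω ^ 2)).row) ↔ _
  rw [← range_vecMulLinear]
  rfl

variable [Fintype F]

/-! ### The field with four elements -/

theorem two_eq_zero (hF : Fintype.card F = 4) : (2 : F) = 0 := by
  have h := Nat.cast_card_eq_zero F
  rw [hF] at h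
  have : (2 : F) * 2 = 0 := by rw [← h]; norm_num
  simpa using this

/-- The map from the model to a field with four elements. -/
def GF4.toField (ω : F) : GF4 → F
  | .zero => 0
  | .one => 1
  | .w => ω
  | .v => ω ^ 2

theorem GF4.toField_injective (hF : Fintype.card F = 4) (ω : F) (hω : ω ^ 2 + ω + 1 = 0) :
    Function.Injective (GF4.toField ω) := by
  have h2 := two_eq_zero hF
  rintro (_ | _ | _ | _) (_ | _ | _ | _) h <;> simp only [GF4.toField] at h <;> first
    | rfl
    | (exfalso; grind)

/-- A field with four elements is isomorphic to the model. -/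
noncomputable def GF4.equiv (hF : Fintype.card F = 4) (ω : F) (hω : ω ^ 2 + ω + 1 = 0) :
    GF4 ≃+* F :=
  have h2 := two_eq_zero hF
  RingEquiv.ofBijective
    ({  toFun := GF4.toField ω
        map_zero' := rfl
        map_one' := rfl
        map_add' := by
          rintro (_ | _ | _ | _) (_ | _ | _ | _) <;>
            simp only [HAdd.hAdd, Add.add, GF4.add] <;>
            change _ = (_ : F) + (_ : F) <;> simp only [GF4.toField] <;> grind
        map_mul' := by
          rintro (_ | _ | _ | _) (_ | _ | _ | _) <;>
            simp only [HMul.hMul, Mul.mul, GF4.mul] <;>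
            change _ = (_ : F) * (_ : F) <;> simp only [GF4.toField] <;> grind } : GF4 →+* F)
    (by
      rw [Fintype.bijective_iff_injective_and_card]
      refine ⟨?_, by rw [hF]; rfl⟩
      exact GF4.toField_injective hF ω hω)

theorem tr_add (hF : Fintype.card F = 4) (x y : F) : tr (x + y) = tr x + tr y := by
  have h2 := two_eq_zero hF
  simp only [tr]
  linear_combination x * y * h2

theorem tr_sub (hF : Fintype.card F = 4) (x y : F) : tr (x - y) = tr x - tr y := by
  have h2 := two_eq_zero hF
  simp only [tr]
  linear_combination (y ^ 2 - x * y) * h2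

theorem tr_sum (hF : Fintype.card F = 4) {ι : Type*} (s : Finset ι) (f : ι → F) :
    tr (∑ i ∈ s, f i) = ∑ i ∈ s, tr (f i) :=
  map_sum (⟨⟨tr, tr_zero⟩, tr_add hF⟩ : F →+ F) f s

theorem pow_four (hF : Fintype.card F = 4) (x : F) : x ^ 4 = x := by
  rw [← hF, FiniteField.pow_card]

theorem tr_sq (hF : Fintype.card F = 4) (x : F) : tr (x ^ 2) = tr x := by
  have h := pow_four hF x
  simp only [tr]
  linear_combination h

/-- Eliminating $z^2$ from the two trace equations leaves $(\omega-\omega^2)z=0$, and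
$\omega-\omega^2=1$ in characteristic $2$. -/
theorem eq_zero_of_tr_eq_zero (hF : Fintype.card F = 4) {ω : F} (hω : ω ^ 2 + ω + 1 = 0) {z : F}
    (h : tr z = 0) (h' : tr (ω * z) = 0) : z = 0 := by
  have h2 := two_eq_zero hF
  simp only [tr] at h h'
  linear_combination h' - ω ^ 2 * h + z * hω - ω * z * h2

theorem sum_sq (hF : Fintype.card F = 4) {ι : Type*} (s : Finset ι) (f : ι → F) :
    (∑ i ∈ s, f i) ^ 2 = ∑ i ∈ s, f i ^ 2 := by
  have h2 := two_eq_zero hF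
  exact map_sum (⟨⟨(· ^ 2), by simp⟩, fun x y => by
    change (x + y) ^ 2 = x ^ 2 + y ^ 2
    linear_combination x * y * h2⟩ : F →+ F) f s

/-! ### The code `S_18` -/

theorem map_modelMatrix (hF : Fintype.card F = 4) (ω : F) (hω : ω ^ 2 + ω + 1 = 0) :
    modelMatrix.map (GF4.equiv hF ω hω) = S18Matrix ω (ω ^ 2) := by
  ext i j
  fin_cases i <;> fin_cases j <;> rfl

section

variable (hF : Fintype.card F = 4) (ω : F) (hω : ω ^ 2 + ω + 1 = 0)

open Matrix in
theorem vecMul_left_mem (a : Fin 9 → F) :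
    a ᵥ* leftMatrix.map (GF4.equiv hF ω hω) ∈ S18 ω := by
  rw [mem_S18_iff]
  refine ⟨a ᵥ* leftChange.map (GF4.equiv hF ω hω), ?_⟩
  rw [← map_modelMatrix hF ω hω, Matrix.vecMul_vecMul, ← leftChange_mul, Matrix.map_mul]

open Matrix in
theorem vecMul_right_mem (a : Fin 9 → F) :
    a ᵥ* rightMatrix.map (GF4.equiv hF ω hω) ∈ S18 ω := by
  rw [mem_S18_iff]
  refine ⟨a ᵥ* rightChange.map (GF4.equiv hF ω hω), ?_⟩
  rw [← map_modelMatrix hF ω hω, Matrix.vecMul_vecMul, ← rightChange_mul, Matrix.map_mul]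

open Matrix in
theorem eq_vecMul_left {c : Fin 18 → F} (hc : c ∈ S18 ω) :
    c = (c ∘ Fin.castAdd 9) ᵥ* leftMatrix.map (GF4.equiv hF ω hω) := by
  obtain ⟨a, rfl⟩ := (mem_S18_iff ω c).1 hc
  have : (a ᵥ* S18Matrix ω (ω ^ 2)) ∘ Fin.castAdd 9 =
      a ᵥ* (modelMatrix.submatrix id (Fin.castAdd 9)).map (GF4.equiv hF ω hω) := by
    rw [← map_modelMatrix hF ω hω]
    rfl
  rw [this, Matrix.vecMul_vecMul, ← Matrix.map_mul, ← modelMatrix_eq_left, map_modelMatrix]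

open Matrix in
theorem eq_vecMul_right {c : Fin 18 → F} (hc : c ∈ S18 ω) :
    c = (c ∘ (Fin.natAdd 9 : Fin 9 → Fin 18)) ᵥ* rightMatrix.map (GF4.equiv hF ω hω) := by
  obtain ⟨a, rfl⟩ := (mem_S18_iff ω c).1 hc
  have : (a ᵥ* S18Matrix ω (ω ^ 2)) ∘ (Fin.natAdd 9 : Fin 9 → Fin 18) =
      a ᵥ* (modelMatrix.submatrix id (Fin.natAdd 9 : Fin 9 → Fin 18)).map (GF4.equiv hF ω hω) := by
    rw [← map_modelMatrix hF ω hω]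
    rfl
  rw [this, Matrix.vecMul_vecMul, ← Matrix.map_mul, ← modelMatrix_eq_right, map_modelMatrix]

open Matrix in
theorem vecMul_left_castAdd (a : Fin 9 → F) :
    (a ᵥ* leftMatrix.map (GF4.equiv hF ω hω)) ∘ Fin.castAdd 9 = a := by
  change a ᵥ* (leftMatrix.submatrix id (Fin.castAdd 9)).map (GF4.equiv hF ω hω) = a
  rw [leftMatrix_submatrix, Matrix.map_one _ (map_zero _) (map_one _), Matrix.vecMul_one]

open Matrix in
theorem vecMul_right_natAdd (a : Fin 9 → F) :
    (a ᵥ* rightMatrix.map (GF4.equiv hF ω hω)) ∘ (Fin.natAdd 9 : Fin 9 → Fin 18) = a := by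
  change a ᵥ* (rightMatrix.submatrix id (Fin.natAdd 9 : Fin 9 → Fin 18)).map (GF4.equiv hF ω hω) = a
  rw [rightMatrix_submatrix, Matrix.map_one _ (map_zero _) (map_one _), Matrix.vecMul_one]

include hF hω

theorem card_S18 : Nat.card (S18 ω) = 2 ^ 18 := by
  have hinj : Function.Injective
      (fun a : Fin 9 → F => Matrix.vecMul a (leftMatrix.map (GF4.equiv hF ω hω))) := by
    intro a b h
    rw [← vecMul_left_castAdd hF ω hω a, ← vecMul_left_castAdd hF ω hω b]
    exact congrArg (· ∘ Fin.castAdd 9) h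
  have hrange : Set.range
      (fun a : Fin 9 → F => Matrix.vecMul a (leftMatrix.map (GF4.equiv hF ω hω))) = S18 ω := by
    ext c
    constructor
    · rintro ⟨a, rfl⟩
      exact vecMul_left_mem hF ω hω a
    · intro hc
      exact ⟨_, (eq_vecMul_left hF ω hω hc).symm⟩
  have := Nat.card_range_of_injective hinj
  rw [hrange, Nat.card_eq_fintype_card (α := Fin 9 → F), Fintype.card_fun, hF,
    Fintype.card_fin] at this
  exact this

open Matrix in
theorem S18_hermitian {c d : Fin 18 → F} (hc : c ∈ S18 ω) (hd : d ∈ S18 ω) :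
    ∑ j, c j * d j ^ 2 = 0 := by
  obtain ⟨a, rfl⟩ := (mem_S18_iff ω c).1 hc
  obtain ⟨b, rfl⟩ := (mem_S18_iff ω d).1 hd
  rw [← map_modelMatrix hF ω hω]
  set e := GF4.equiv hF ω hω
  have hsq : (fun j => (b ᵥ* modelMatrix.map e) j ^ 2) =
      (fun i => b i ^ 2) ᵥ* (modelMatrix.map (· ^ 2)).map e := by
    funext j
    simp [Matrix.vecMul, dotProduct, sum_sq hF, mul_pow]
  change (a ᵥ* modelMatrix.map e) ⬝ᵥ (fun j => (b ᵥ* modelMatrix.map e) j ^ 2) = 0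
  rw [hsq, ← Matrix.mulVec_transpose ((modelMatrix.map (· ^ 2)).map e),
    ← Matrix.dotProduct_mulVec, Matrix.mulVec_mulVec, ← Matrix.transpose_map, ← Matrix.map_mul,
    modelMatrix_hermitian]
  simp

/-- For a code closed under scalars, trace orthogonality upgrades to Hermitian orthogonality:
testing `x` against $c$ and $\omega^2c$ gives the traces of $z$ and $\omega z$, where $z$ is the
Hermitian product and $\overline{\omega^2}=\omega$. -/
theorem hermitian_of_mem_traceDual {C : AddSubgroup (Fin 18 → F)}
    (hC : ∀ c ∈ C, ∀ a : F, a • c ∈ C) {x : Fin 18 → F} (hx : x ∈ traceDual C) {c : Fin 18 → F}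
    (hc : c ∈ C) : ∑ j, x j * c j ^ 2 = 0 := by
  refine eq_zero_of_tr_eq_zero hF hω ?_ ?_
  · rw [tr_sum hF]
    exact hx c hc
  · have h := hx _ (hC c hc (ω ^ 2))
    rw [Finset.mul_sum, tr_sum hF, ← h]
    refine Finset.sum_congr rfl fun j _ => congrArg tr ?_
    simp only [Pi.smul_apply, smul_eq_mul]
    linear_combination -(x j * c j ^ 2) * pow_four hF ω

theorem S18_selfDual : IsSelfDual (S18 ω) := by
  ext x
  constructor
  · intro hx
    have hx' := fun {c} => hermitian_of_mem_traceDual hF ω hω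
      (fun c hc a => smul_mem_S18 hc a) hx (c := c)
    -- The codeword that agrees with `x` on the left half; it remains to compare the right halves.
    set c := Matrix.vecMul (x ∘ Fin.castAdd 9) (leftMatrix.map (GF4.equiv hF ω hω)) with hc
    have hcm : c ∈ S18 ω := vecMul_left_mem hF ω hω _
    have hleft (i : Fin 9) : x (Fin.castAdd 9 i) = c (Fin.castAdd 9 i) :=
      (congrFun (vecMul_left_castAdd hF ω hω (x ∘ Fin.castAdd 9)) i).symm
    suffices x = c by rw [this]; exact hcm
    funext j
    refine Fin.addCases (m := 9) (n := 9) hleft (fun i => ?_) j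
    -- On the right half the row `r` is a unit vector, so its products with `x` and with `c`, both
    -- zero, have equal left parts and isolate the entries of `x` and `c` at coordinate $9+i$.
    set r := Matrix.vecMul (Pi.single i 1) (rightMatrix.map (GF4.equiv hF ω hω)) with hr
    have hrm : r ∈ S18 ω := vecMul_right_mem hF ω hω _
    have hright (k : Fin 9) : r (Fin.natAdd 9 k) = (Pi.single i 1 : Fin 9 → F) k :=
      congrFun (vecMul_right_natAdd hF ω hω (Pi.single i 1)) k
    have h1 := hx' hrm
    have h2 := S18_hermitian hF ω hω hcm hrm
    rw [Fin.sum_univ_add (a := 9) (b := 9)] at h1 h2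
    simp only [hright, hleft, Pi.single_apply, ite_pow, one_pow, ne_eq, OfNat.ofNat_ne_zero,
      not_false_eq_true, zero_pow, mul_ite, mul_one, mul_zero, Finset.sum_ite_eq',
      Finset.mem_univ, if_true] at h1 h2
    exact add_left_cancel (h1.trans h2.symm)
  · intro hx c hc
    rw [traceInner, ← tr_sum hF, S18_hermitian hF ω hω hx hc, tr_zero]

variable [DecidableEq F]

theorem S18_even : IsEven (S18 ω) := by
  intro c hc
  have h := S18_hermitian hF ω hω hc hc
  have h1 (x : F) : x * x ^ 2 = if x ≠ 0 then 1 else 0 := by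
    split_ifs with hx
    · have := FiniteField.pow_card_sub_one_eq_one x hx
      rw [hF] at this
      rw [← this]
      ring
    · simp [not_not.1 hx]
  simp only [h1, Finset.sum_boole] at h
  have : CharP F 2 := CharTwo.of_one_ne_zero_of_two_eq_zero one_ne_zero (two_eq_zero hF)
  exact even_iff_two_dvd.2 ((CharP.cast_eq_zero_iff F 2 _).1 h)

theorem le_hammingNorm_of_mem_S18 {c : Fin 18 → F} (hc : c ∈ S18 ω) (h0 : c ≠ 0) :
    8 ≤ hammingNorm c := by
  set e := GF4.equiv hF ω hω with he
  set k : Fin 18 → GF4 := e.symm ∘ c with hk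
  have hck : c = e ∘ k := by funext j; simp [hk]
  have hnorm : hammingNorm c = hammingNorm k := by
    rw [hck]
    exact hammingNorm_comp (fun _ => e) (fun _ => e.injective) (fun _ => map_zero e)
  have hk0 : k ≠ 0 := by
    rw [← hammingNorm_ne_zero_iff, ← hnorm, hammingNorm_ne_zero_iff]
    exact h0
  have hl : k = ∑ i, (k ∘ Fin.castAdd 9) i • leftMatrix i := by
    funext j
    apply e.injective
    have := congrFun (eq_vecMul_left hF ω hω hc) j
    rw [hck] at this
    simpa [Matrix.vecMul, dotProduct, Finset.sum_apply, he] using this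
  have hr : k = ∑ i, (k ∘ (Fin.natAdd 9 : Fin 9 → Fin 18)) i • rightMatrix i := by
    funext j
    apply e.injective
    have := congrFun (eq_vecMul_right hF ω hω hc) j
    rw [hck] at this
    simpa [Matrix.vecMul, dotProduct, Finset.sum_apply, he] using this
  have h1 := checkMonic_sound 9 _ _ checkMonic_left (k ∘ Fin.castAdd 9)
  have h2 := checkMonic_sound 9 _ _ checkMonic_right (k ∘ (Fin.natAdd 9 : Fin 9 → Fin 18))
  rw [← hl] at h1
  rw [← hr] at h2
  simp only [hk0, false_or] at h1 h2
  have h3 := hammingNorm_add 9 9 k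
  have h4 := S18_even hF ω hω c hc
  rw [hnorm] at h4 ⊢
  obtain ⟨t, ht⟩ := h4
  by_contra hlt
  -- The two halves have weights at least $4$ and $3$, so the total is at least $7$, and evenness
  -- raises this to $8$.
  have : 3 < hammingNorm (k ∘ Fin.castAdd 9) := by
    by_contra h; exact hlt (h1 (by omega))
  have : 2 < hammingNorm (k ∘ (Fin.natAdd 9 : Fin 9 → Fin 18)) := by
    by_contra h; exact hlt (h2 (by omega))
  omega

end

end Code

/-! ### Orthogonal arrays from the dual distance -/

section OrthogonalArray

variable {F : Type*} [Field F] [DecidableEq F] {n d : ℕ}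

/-- If every nonzero vector orthogonal to the linear code `C` has weight larger than `d`, then every
pattern on at most `d` coordinates extends to a codeword. -/
theorem exists_mem_eq_on (C : Submodule F (Fin n → F))
    (hC : ∀ x : Fin n → F, (∀ c ∈ C, ∑ j, x j * c j = 0) → x ≠ 0 → d < hammingNorm x)
    (S : Finset (Fin n)) (hS : #S ≤ d) (f : S → F) : ∃ c ∈ C, ∀ i : S, c i = f i := by
  classical
  let π : C →ₗ[F] (S → F) := (LinearMap.funLeft F F (Subtype.val : S → Fin n)).comp C.subtype
  suffices h : LinearMap.range π = ⊤ by
    obtain ⟨c, hc⟩ := LinearMap.range_eq_top.1 h f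
    exact ⟨c, c.2, fun i => congrFun hc i⟩
  by_contra hne
  -- If the projection to `S` is not onto, a nonzero functional kills its image. Extended by zero
  -- outside `S`, its coefficients form a nonzero vector orthogonal to `C` of weight at most `d`.
  obtain ⟨φ, hφ, hle⟩ := Submodule.exists_le_ker_of_lt_top _ (lt_top_iff_ne_top.2 hne)
  let x : Fin n → F := fun j => if h : j ∈ S then φ (Pi.single ⟨j, h⟩ 1) else 0
  have hx (i : S) : x i = φ (Pi.single i 1) := by simp [x]
  have hsum (c : Fin n → F) : ∑ j, x j * c j = φ fun i : S => c i := by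
    rw [LinearMap.pi_apply_eq_sum_univ φ, ← Finset.sum_subset (Finset.subset_univ S),
      ← Finset.sum_coe_sort S]
    · refine Finset.sum_congr rfl fun i _ => ?_
      rw [hx, smul_eq_mul, mul_comm]
      congr 2
      ext k
      simp [Pi.single_apply, eq_comm]
    · intro j _ hj
      simp [x, hj]
  have h1 := hC x (fun c hc => by
    rw [hsum]
    exact hle ⟨⟨c, hc⟩, rfl⟩) (by
      rintro h0
      apply hφ
      refine LinearMap.pi_ext' fun i => LinearMap.ext_ring ?_
      simpa [h0] using (hx i).symm)
  have h2 : hammingNorm x ≤ #S := by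
    refine Finset.card_le_card fun j hj => ?_
    by_contra h
    simp [x, h] at hj
  omega

variable [Fintype F]

open Classical in
/-- Codewords with a prescribed pattern on at most `d` coordinates are equidistributed. -/
theorem card_eq_on_mul (C : Submodule F (Fin n → F))
    (hC : ∀ x : Fin n → F, (∀ c ∈ C, ∑ j, x j * c j = 0) → x ≠ 0 → d < hammingNorm x)
    (S : Finset (Fin n)) (hS : #S ≤ d) (f : Fin n → F) :
    #{c : Fin n → F | c ∈ C ∧ ∀ i ∈ S, c i = f i} * Fintype.card F ^ #S = Nat.card C := by
  -- Translation by a codeword that equals `f - g` on `S` carries one fibre of the projection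
  -- bijectively to the other.
  have hconst (g : S → F) : #{c : Fin n → F | c ∈ C ∧ ∀ i : S, c i = g i} =
      #{c : Fin n → F | c ∈ C ∧ ∀ i ∈ S, c i = f i} := by
    obtain ⟨u, hu, hug⟩ := exists_mem_eq_on C hC S hS fun i => f i - g i
    refine Finset.card_bij' (fun c _ => c + u) (fun c _ => c - u) ?_ ?_ (by simp) (by simp)
    · intro c hc
      simp only [Finset.mem_filter, Finset.mem_univ, true_and] at hc ⊢
      exact ⟨C.add_mem hc.1 hu, fun i hi => by
        rw [Pi.add_apply, hug ⟨i, hi⟩, hc.2 ⟨i, hi⟩]; ring⟩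
    · intro c hc
      simp only [Finset.mem_filter, Finset.mem_univ, true_and] at hc ⊢
      exact ⟨C.sub_mem hc.1 hu, fun i => by
        rw [Pi.sub_apply, hug i, hc.2 i i.2]; ring⟩
  have htotal : Nat.card C = #{c : Fin n → F | c ∈ C} := by
    rw [Nat.card_eq_fintype_card, Fintype.card_subtype]
  rw [htotal, Finset.card_eq_sum_card_fiberwise (s := ({c | c ∈ C} : Finset (Fin n → F)))
    (f := fun c (i : S) => c i) (t := Finset.univ) (fun _ _ => Finset.mem_coe.2 (Finset.mem_univ _))]
  simp only [Finset.filter_filter, funext_iff, hconst]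
  simp [mul_comm]

open Classical in
/-- The binomial moments of the numbers of zeros of the codewords with a prescribed pattern of
nonzero entries on `S`. -/
theorem sum_choose_zeros (C : Submodule F (Fin n → F))
    (hC : ∀ x : Fin n → F, (∀ c ∈ C, ∑ j, x j * c j = 0) → x ≠ 0 → d < hammingNorm x)
    (S : Finset (Fin n)) (f : Fin n → F) (hf : ∀ i ∈ S, f i ≠ 0) (t : ℕ) (ht : #S + t ≤ d) :
    (∑ c : Fin n → F with c ∈ C ∧ ∀ i ∈ S, c i = f i, (n - hammingNorm c).choose t) *
      Fintype.card F ^ (#S + t) = (n - #S).choose t * Nat.card C := by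
  -- The binomial coefficient counts the `t`-sets of zeros of `c`; these avoid `S` because `f` is
  -- nonzero there. The sum over `c` is then counted by `T` instead.
  have hzeros (c : Fin n → F) (hc : ∀ i ∈ S, c i = f i) : (n - hammingNorm c).choose t =
      #{T ∈ powersetCard t Sᶜ | ∀ i ∈ T, c i = 0} := by
    have h1 : #{i | c i = 0} = n - hammingNorm c := by
      have := Finset.card_filter_add_card_filter_not (s := univ) (p := fun i => c i = 0)
      rw [Finset.card_univ, Fintype.card_fin] at this
      simp only [hammingNorm, ne_eq]
      omega
    rw [← h1, ← Finset.card_powersetCard]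
    congr 1
    ext T
    simp only [Finset.mem_powersetCard, Finset.mem_filter, Finset.subset_iff, Finset.mem_univ,
      true_and, Finset.mem_compl]
    constructor
    · rintro ⟨h, hT⟩
      exact ⟨⟨fun i hi hiS => hf i hiS ((hc i hiS).symm.trans (h hi)), hT⟩, fun i hi => h hi⟩
    · rintro ⟨⟨-, hT⟩, h⟩
      exact ⟨@h, hT⟩
  rw [Finset.sum_congr rfl fun c hc => hzeros c (Finset.mem_filter.1 hc).2.2]
  have := Finset.sum_card_bipartiteAbove_eq_sum_card_bipartiteBelow
    (s := ({c : Fin n → F | c ∈ C ∧ ∀ i ∈ S, c i = f i} : Finset (Fin n → F)))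
    (t := powersetCard t Sᶜ) (r := fun c T => ∀ i ∈ T, c i = 0)
  simp only [Finset.bipartiteAbove, Finset.bipartiteBelow] at this
  rw [this, Finset.sum_mul]
  -- For fixed `T` the word is prescribed on `S ∪ T`: by `f` on `S` and by zero on `T`.
  have hcount : ∀ T ∈ powersetCard t Sᶜ,
      #{c ∈ ({c : Fin n → F | c ∈ C ∧ ∀ i ∈ S, c i = f i} : Finset (Fin n → F)) |
        ∀ i ∈ T, c i = 0} * Fintype.card F ^ (#S + t) = Nat.card C := by
    intro T hT
    obtain ⟨hTS, hTc⟩ := Finset.mem_powersetCard.1 hT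
    have hdisj : Disjoint S T := by
      rw [Finset.disjoint_right]
      exact fun i hi => Finset.mem_compl.1 (hTS hi)
    have hcard : #(S ∪ T) = #S + t := by rw [Finset.card_union_of_disjoint hdisj, hTc]
    rw [← card_eq_on_mul C hC (S ∪ T) (hcard ▸ ht) (fun i => if i ∈ S then f i else 0), hcard,
      Finset.filter_filter]
    congr 3
    ext c
    constructor
    · rintro ⟨⟨hc, h1⟩, h2⟩
      refine ⟨hc, fun i hi => ?_⟩
      split_ifs with hiS
      · exact h1 i hiS
      · exact h2 i ((Finset.mem_union.1 hi).resolve_left hiS)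
    · rintro ⟨hc, h⟩
      refine ⟨⟨hc, fun i hi => ?_⟩, fun i hi => ?_⟩
      · simpa [hi] using h i (Finset.mem_union_left _ hi)
      · simpa [Finset.disjoint_right.1 hdisj hi] using h i (Finset.mem_union_right _ hi)
  rw [Finset.sum_congr rfl hcount, Finset.sum_const, Finset.card_powersetCard, Finset.card_compl,
    Fintype.card_fin, smul_eq_mul]

end OrthogonalArray

/-! ### Dual distance and weight counts of `S_18` -/

section Weights

variable {F : Type*} [Field F] [Fintype F] [DecidableEq F]
  (hF : Fintype.card F = 4) (ω : F) (hω : ω ^ 2 + ω + 1 = 0)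

include hF hω

/-- Conjugation takes the Euclidean dual to the Hermitian dual, which is the code itself, and
preserves weight; hence the strength $7$ used below. -/
theorem lt_hammingNorm_of_orthogonal (x : Fin 18 → F)
    (hx : ∀ c ∈ S18 ω, ∑ j, x j * c j = 0) (h0 : x ≠ 0) : 7 < hammingNorm x := by
  have hmem : (fun j => x j ^ 2) ∈ S18 ω := by
    have : (fun j => x j ^ 2) ∈ traceDual (S18 ω) := by
      intro c hc
      rw [traceInner, ← tr_sum hF]
      simp only [← mul_pow]
      rw [← sum_sq hF, hx c hc, zero_pow two_ne_zero, tr_zero]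
    rwa [S18_selfDual hF ω hω] at this
  have hnorm : hammingNorm (fun j => x j ^ 2) = hammingNorm x := by
    simp [hammingNorm]
  rw [← hnorm]
  refine le_hammingNorm_of_mem_S18 hF ω hω hmem ?_
  rwa [← hammingNorm_ne_zero_iff, hnorm, hammingNorm_ne_zero_iff]

theorem exists_hammingNorm_eq {c : Fin 18 → F} (hc : c ∈ S18 ω) (h0 : c ≠ 0) :
    ∃ k : Fin 6, hammingNorm c = 8 + 2 * k := by
  have h1 := le_hammingNorm_of_mem_S18 hF ω hω hc h0
  obtain ⟨t, ht⟩ := S18_even hF ω hω c hc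
  have h2 : hammingNorm c ≤ 18 := by simpa using hammingNorm_le_card_fintype (x := c)
  exact ⟨⟨t - 4, by omega⟩, by simp only; omega⟩

theorem sum_comp_hammingNorm (D : Finset (Fin 18 → F)) (hD : ∀ c ∈ D, c ∈ S18 ω ∧ c ≠ 0)
    (g : ℕ → ℕ) : ∑ c ∈ D, g (hammingNorm c) =
      ∑ k : Fin 6, #{c ∈ D | hammingNorm c = 8 + 2 * k} * g (8 + 2 * k) := by
  simp only [Finset.card_filter, Finset.sum_mul, ite_mul, one_mul, zero_mul]
  rw [Finset.sum_comm]
  refine Finset.sum_congr rfl fun c hc => ?_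
  obtain ⟨k, hk⟩ := exists_hammingNorm_eq hF ω hω (hD c hc).1 (hD c hc).2
  rw [Finset.sum_eq_single k]
  · simp [hk]
  · intro l _ hl
    rw [if_neg]
    omega
  · simp

open Classical in
theorem sum_choose_zeros_S18 (S : Finset (Fin 18)) (f : Fin 18 → F) (hf : ∀ i ∈ S, f i ≠ 0)
    (t : ℕ) (ht : #S + t ≤ 7) :
    (∑ c : Fin 18 → F with c ∈ S18 ω ∧ ∀ i ∈ S, c i = f i, (18 - hammingNorm c).choose t) *
      4 ^ (#S + t) = (18 - #S).choose t * 2 ^ 18 := by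
  have h := sum_choose_zeros (Submodule.span F (Set.range (S18Matrix ω (ω ^ 2)).row))
    (lt_hammingNorm_of_orthogonal hF ω hω) S f hf t ht
  rw [hF] at h
  rw [← card_S18 hF ω hω]
  exact h

/-- To c-cover `e` is to have one prescribed nonzero coordinate, so the moments with `#S = 1` apply.
The numbers of zeros $10,8,6,4,2,0$ are distinct, so the moments of order $0,\dots,5$ form an
invertible system for the six counts. -/
theorem mu_S18 (k : Fin 6) (e : Fin 18 → F) (he : hammingNorm e = 1) :
    mu (S18 ω) (8 + 2 * k) e = (![408, 3400, 17136, 28560, 15096, 936] : Fin 6 → ℕ) k := by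
  classical
  obtain ⟨j, hj⟩ := Finset.card_eq_one.1 he
  have hej (i : Fin 18) : e i ≠ 0 ↔ i = j := by simpa using Finset.ext_iff.1 hj i
  set D : Finset (Fin 18 → F) := {c | c ∈ S18 ω ∧ ∀ i ∈ ({j} : Finset (Fin 18)), c i = e i}
    with hD
  have hcov (k : Fin 6) : mu (S18 ω) (8 + 2 * k) e = #{c ∈ D | hammingNorm c = 8 + 2 * k} := by
    rw [mu, hD, Finset.filter_filter]
    congr 1
    ext c
    simp only [CCovered, hej, Finset.mem_filter, Finset.mem_univ, true_and, forall_eq,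
      Finset.mem_singleton]
    constructor
    · rintro ⟨h1, h2, h3⟩
      exact ⟨⟨h1, h3.symm⟩, h2⟩
    · rintro ⟨⟨h1, h3⟩, h2⟩
      exact ⟨h1, h2, h3.symm⟩
  have hmom (t : ℕ) (ht : t ≤ 6) := sum_choose_zeros_S18 hF ω hω {j} e
    (fun i hi => (hej i).2 (Finset.mem_singleton.1 hi)) t (by simp; omega)
  have hsum (t : ℕ) := sum_comp_hammingNorm hF ω hω D (fun c hc => by
    obtain ⟨h1, h2⟩ := (Finset.mem_filter.1 hc).2
    refine ⟨h1, ?_⟩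
    rintro rfl
    exact (hej j).2 rfl (h2 j (Finset.mem_singleton_self j)).symm) (fun w => (18 - w).choose t)
  simp only [← hD, hsum, ← hcov] at hmom
  have h0 := hmom 0 (by omega)
  have h1 := hmom 1 (by omega)
  have h2 := hmom 2 (by omega)
  have h3 := hmom 3 (by omega)
  have h4 := hmom 4 (by omega)
  have h5 := hmom 5 (by omega)
  clear hmom hsum
  simp [Fin.sum_univ_six, Nat.choose] at h0 h1 h2 h3 h4 h5
  fin_cases k <;> simp <;> omega

/-- The same system with `S` empty. The zero word now takes part in every moment, contributing
$\binom{18}{t}$, and is split off. -/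
theorem weightCount_S18 (k : Fin 6) : weightCount (S18 ω) (8 + 2 * k) =
    (![2754, 18360, 77112, 110160, 50949, 2808] : Fin 6 → ℕ) k := by
  classical
  set D : Finset (Fin 18 → F) := {c | c ∈ S18 ω ∧ ∀ i ∈ (∅ : Finset (Fin 18)), c i = 0} with hD
  have h0D : (0 : Fin 18 → F) ∈ D := by simp [hD, zero_mem]
  have hcount (k : Fin 6) : weightCount (S18 ω) (8 + 2 * k) =
      #{c ∈ D.erase 0 | hammingNorm c = 8 + 2 * k} := by
    rw [weightCount]
    congr 1
    ext c
    simp only [hD, Finset.mem_filter, Finset.mem_univ, true_and, Finset.mem_erase,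
      Finset.notMem_empty, false_implies, implies_true, and_true]
    refine ⟨fun ⟨h1, h2⟩ => ⟨⟨?_, h1⟩, h2⟩, fun h => ⟨h.1.2, h.2⟩⟩
    rintro rfl
    rw [hammingNorm_zero] at h2
    omega
  have hmom (t : ℕ) (ht : t ≤ 7) := sum_choose_zeros_S18 hF ω hω ∅ 0 (by simp) t (by simp; omega)
  have hsum (t : ℕ) := sum_comp_hammingNorm hF ω hω (D.erase 0) (fun c hc => by
    obtain ⟨h1, h2⟩ := Finset.mem_erase.1 hc
    exact ⟨(Finset.mem_filter.1 h2).2.1, h1⟩) (fun w => (18 - w).choose t)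
  simp only [Pi.zero_apply, ← hD, ← Finset.add_sum_erase D _ h0D, hsum, ← hcount] at hmom
  have h0 := hmom 0 (by omega)
  have h1 := hmom 1 (by omega)
  have h2 := hmom 2 (by omega)
  have h3 := hmom 3 (by omega)
  have h4 := hmom 4 (by omega)
  have h5 := hmom 5 (by omega)
  clear hmom hsum
  simp [Fin.sum_univ_six, Nat.choose] at h0 h1 h2 h3 h4 h5
  fin_cases k <;> simp <;> omega

theorem hasMinWeight_S18 : HasMinWeight (S18 ω) 8 := by
  classical
  constructor
  · have h := weightCount_S18 hF ω hω 0
    have hpos : 0 < weightCount (S18 ω) (8 + 2 * (0 : Fin 6)) := by rw [h]; decide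
    obtain ⟨c, hc⟩ := Finset.card_pos.1 hpos
    obtain ⟨h1, h2⟩ := (Finset.mem_filter.1 hc).2
    refine ⟨c, h1, ?_, h2⟩
    rintro rfl
    simp at h2
  · rintro w ⟨c, hc, h0, rfl⟩
    exact le_hammingNorm_of_mem_S18 hF ω hω hc h0

end Weights

/-! ### The access structure of `S_18` -/

section Scheme

theorem card_group_add_one {F : Type*} [Field F] [DecidableEq F] {x : Fin 18 → F} (hx : x 0 ≠ 0) :
    #(group x) + 1 = hammingNorm x := by
  rw [group, hammingNorm]
  exact Finset.card_erase_add_one (by simpa using hx)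

theorem countP_product {α β : Type*} (s : Multiset α) (t : Multiset β) (p : α → Prop)
    (q : β → Prop) [DecidablePred p] [DecidablePred q] :
    (s ×ˢ t).countP (fun x => p x.1 ∧ q x.2) = s.countP p * t.countP q := by
  induction s using Multiset.induction_on with
  | empty => simp
  | cons a s ih =>
    rw [Multiset.cons_product, Multiset.countP_add, ih, Multiset.countP_map, Multiset.countP_cons]
    by_cases h : p a
    · simp [h, Multiset.countP_eq_card_filter, add_mul, Nat.add_comm]
    · simp [h]

theorem omega_ne_zero {F : Type*} [Field F] {ω : F} (hω : ω ^ 2 + ω + 1 = 0) : ω ≠ 0 := by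
  rintro rfl
  simp at hω


theorem scal_ne_zero {F : Type*} [Field F] {ω : F} (hω : ω ^ 2 + ω + 1 = 0) (i : Fin 3) :
    scal ω i ≠ 0 := by
  have := omega_ne_zero hω
  fin_cases i <;> simp [scal, this]

/-- Two distinct elements among $1,\omega,\omega^2$ form a basis over the prime field, and the trace
form is nondegenerate. -/
theorem eq_zero_of_alpha {F : Type*} [Field F] [Fintype F] (hF : Fintype.card F = 4) {ω : F}
    (hω : ω ^ 2 + ω + 1 = 0) {i j : Fin 3} (hij : i ≠ j) {s : F} (hi : alpha ω i s = 0)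
    (hj : alpha ω j s = 0) : s = 0 := by
  have h2 := two_eq_zero hF
  simp only [alpha, tr] at hi hj
  have h3 : ω ^ 3 = 1 := by linear_combination (ω - 1) * hω
  have h4 := pow_four hF ω
  have hω0 := omega_ne_zero hω
  fin_cases i <;> fin_cases j <;> simp [scal] at hi hj hij <;> grind

/-- The witness $\omega a_i$ is chosen so that $\omega a_i\overline{a_i}=\omega$, whose trace is
$1$. -/
theorem alpha_ne {F : Type*} [Field F] [Fintype F] (hF : Fintype.card F = 4) {ω : F}
    (hω : ω ^ 2 + ω + 1 = 0) (i : Fin 3) : alpha ω i (ω * scal ω i) ≠ alpha ω i 0 := by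
  have h3 : scal ω i ^ 3 = 1 := by
    have := FiniteField.pow_card_sub_one_eq_one _ (scal_ne_zero hω i)
    rwa [hF] at this
  have : ω * scal ω i * scal ω i ^ 2 = ω := by linear_combination ω * h3
  rw [alpha, alpha, this, zero_mul, tr_zero, tr]
  intro h
  exact one_ne_zero (α := F) (by linear_combination hω - h)

variable {F : Type*} [Field F] [Fintype F] [DecidableEq F]
  (hF : Fintype.card F = 4) (ω : F) (hω : ω ^ 2 + ω + 1 = 0)

include hF hω

/-- The further nonzero coordinate required by `H` is automatic, since a word supported at `0` alone
would have weight $1<8$. -/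
theorem mem_H_S18 (i : Fin 3) (x : Fin 18 → F) :
    x ∈ H ω (S18 ω) i ↔ x ∈ S18 ω ∧ x 0 = scal ω i := by
  have hd : traceDual (S18 ω) = S18 ω := S18_selfDual hF ω hω
  simp only [H, hd, Finset.mem_filter, Finset.mem_univ, true_and, SetLike.mem_coe]
  refine ⟨fun h => ⟨h.1, h.2.1⟩, fun ⟨h1, h2⟩ => ⟨h1, h2, ?_⟩⟩
  by_contra! h
  have h8 := le_hammingNorm_of_mem_S18 hF ω hω h1 (by
    rintro rfl
    exact scal_ne_zero hω i h2.symm)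
  have : hammingNorm x ≤ #{(0 : Fin 18)} := by
    refine Finset.card_le_card fun j hj => ?_
    by_contra hne
    exact (Finset.mem_filter.1 hj).2 (h j (by simpa using hne))
  simp at this
  omega

theorem muI_S18 (i : Fin 3) (k : Fin 6) :
    muI ω (S18 ω) i (8 + 2 * k) (Pi.single 0 (scal ω i)) =
      (![408, 3400, 17136, 28560, 15096, 936] : Fin 6 → ℕ) k := by
  have hs := scal_ne_zero hω i
  rw [← mu_S18 hF ω hω k (Pi.single 0 (scal ω i)) (by
    rw [hammingNorm, Finset.card_eq_one]
    refine ⟨0, ?_⟩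
    ext j
    simp [Pi.single_apply, hs]), muI, mu]
  congr 1
  ext x
  simp only [Finset.mem_filter, mem_H_S18 hF ω hω, Finset.mem_univ, true_and]
  refine ⟨fun h => ⟨h.1.1, h.2⟩, fun h => ⟨⟨h.1, ?_⟩, h.2⟩⟩
  have := h.2.2 0
  simp only [Pi.single_eq_same] at this
  exact (this hs).symm

theorem ne_zero_of_mem_H {i : Fin 3} {x : Fin 18 → F} (hx : x ∈ H ω (S18 ω) i) : x 0 ≠ 0 := by
  rw [((mem_H_S18 hF ω hω i x).1 hx).2]
  exact scal_ne_zero hω i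

theorem exists_card_group_eq {i : Fin 3} {x : Fin 18 → F} (hx : x ∈ H ω (S18 ω) i) :
    ∃ k : Fin 6, #(group x) = 7 + 2 * k := by
  have h0 := ne_zero_of_mem_H hF ω hω hx
  obtain ⟨k, hk⟩ := exists_hammingNorm_eq hF ω hω ((mem_H_S18 hF ω hω i x).1 hx).1
    (by rintro rfl; exact h0 rfl)
  have := card_group_add_one h0
  exact ⟨k, by omega⟩

theorem countP_GammaH (i : Fin 3) (k : Fin 6) :
    (GammaH ω (S18 ω) i).countP (fun s => #s = 7 + 2 * k) =
      (![408, 3400, 17136, 28560, 15096, 936] : Fin 6 → ℕ) k := by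
  classical
  rw [← muI_S18 hF ω hω i k, GammaH, Multiset.countP_map, muI, Finset.card_def,
    Finset.filter_val]
  congr 1
  refine Multiset.filter_congr fun x hx => ?_
  have hx' : x ∈ H ω (S18 ω) i := hx
  have := card_group_add_one (ne_zero_of_mem_H hF ω hω hx')
  have hcov : CCovered (Pi.single 0 (scal ω i)) x := by
    intro j hj
    by_cases h : j = 0
    · rw [h, Pi.single_eq_same, ((mem_H_S18 hF ω hω i x).1 hx').2]
    · simp [h] at hj
  simp only [hcov, and_true]
  omega

theorem card_GammaH (i : Fin 3) : Multiset.card (GammaH ω (S18 ω) i) = 2 ^ 16 := by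
  classical
  rw [GammaH, Multiset.card_map]
  have h := sum_choose_zeros_S18 hF ω hω {0} (fun _ => scal ω i)
    (fun _ _ => scal_ne_zero hω i) 0 (by simp)
  have hH : H ω (S18 ω) i = ({c | c ∈ S18 ω ∧ ∀ j ∈ ({0} : Finset (Fin 18)), c j = scal ω i} :
      Finset (Fin 18 → F)) := by
    ext x
    simp [mem_H_S18 hF ω hω]
  rw [← hH] at h
  simp at h
  change #(H ω (S18 ω) i) = _
  omega

/-- Multiplication by $a_i$ is a support-preserving bijection between the two sets of words, so even
the multiplicities agree. -/
theorem GammaH_eq (i : Fin 3) : GammaH ω (S18 ω) i = GammaH ω (S18 ω) 0 := by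
  classical
  have hs := scal_ne_zero hω i
  have hH : H ω (S18 ω) i = (H ω (S18 ω) 0).map
      ⟨(scal ω i • ·), smul_right_injective (Fin 18 → F) hs⟩ := by
    ext x
    simp only [Finset.mem_map, mem_H_S18 hF ω hω, Function.Embedding.coeFn_mk]
    have h1' : scal ω 0 = 1 := rfl
    constructor
    · rintro ⟨h1, h2⟩
      refine ⟨(scal ω i)⁻¹ • x, ⟨smul_mem_S18 h1 _, ?_⟩, ?_⟩
      · rw [Pi.smul_apply, h2, smul_eq_mul, inv_mul_cancel₀ hs, h1']
      · rw [smul_smul, mul_inv_cancel₀ hs, one_smul]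
    · rintro ⟨y, ⟨h1, h2⟩, rfl⟩
      refine ⟨smul_mem_S18 h1 _, ?_⟩
      rw [Pi.smul_apply, h2, h1', smul_eq_mul, mul_one]
  rw [GammaH, hH, Finset.map_val, Multiset.map_map, GammaH]
  refine Multiset.map_congr rfl fun x _ => ?_
  simp [group, hs]

/-- The six families are the same multiset, and a union by maximal multiplicities of equal multisets
changes nothing. -/
theorem Gamma_eq : Gamma ω (S18 ω) = GammaH ω (S18 ω) 0 ×ˢ GammaH ω (S18 ω) 0 := by
  rw [Gamma, Finset.sup_congr rfl fun ij _ => by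
    rw [GammaH_eq hF ω hω ij.1, GammaH_eq hF ω hω ij.2]]
  exact Finset.sup_const ⟨(0, 1), by decide⟩ _

theorem hasS18Sizes_product (i j : Fin 3) :
    HasS18Sizes (GammaH ω (S18 ω) i ×ˢ GammaH ω (S18 ω) j) := by
  constructor
  · intro k l
    rw [sizeCount, countP_product _ _ (fun s => #s = 7 + 2 * (k : ℕ))
      (fun s => #s = 7 + 2 * (l : ℕ)),
      countP_GammaH hF ω hω, countP_GammaH hF ω hω]
    fin_cases k <;> fin_cases l <;> rfl
  · intro s hs
    obtain ⟨h1, h2⟩ := Multiset.mem_product.1 hs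
    obtain ⟨x, hx, hxs⟩ := Multiset.mem_map.1 h1
    obtain ⟨y, hy, hys⟩ := Multiset.mem_map.1 h2
    obtain ⟨k, hk⟩ := exists_card_group_eq hF ω hω (i := i) hx
    obtain ⟨l, hl⟩ := exists_card_group_eq hF ω hω (i := j) hy
    exact ⟨k, l, hxs ▸ hk, hys ▸ hl⟩

theorem accessibilityDegree_product (i j : Fin 3) :
    accessibilityDegree (GammaH ω (S18 ω) i ×ˢ GammaH ω (S18 ω) j) = 1 / 4 := by
  rw [accessibilityDegree, Multiset.card_product, card_GammaH hF ω hω, card_GammaH hF ω hω]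
  norm_num

/-- In the Hermitian product of `x` and `d` only coordinate `0` survives, which gives
$a_i\overline{d_0}=0$. This is the conjugate of $d_0\overline{a_i}$, and the trace is invariant
under conjugation. -/
theorem alpha_eq_zero_of_mem_H {i : Fin 3} {x : Fin 18 → F} (hx : x ∈ H ω (S18 ω) i)
    {d : Fin 18 → F} (hd : d ∈ S18 ω) (h : ∀ j ∈ group x, d j = 0) : alpha ω i (d 0) = 0 := by
  obtain ⟨h1, h2⟩ := (mem_H_S18 hF ω hω i x).1 hx
  have horth := S18_hermitian hF ω hω h1 hd
  rw [Finset.sum_eq_single 0, h2] at horth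
  · rw [alpha, ← tr_sq hF]
    have : (d 0 * scal ω i ^ 2) ^ 2 = scal ω i * d 0 ^ 2 := by
      linear_combination d 0 ^ 2 * pow_four hF (scal ω i)
    rw [this, horth, tr_zero]
  · intro j _ hj
    by_cases hxj : x j = 0
    · simp [hxj]
    · simp [h j (Finset.mem_erase.2 ⟨hj, by simpa using hxj⟩)]
  · simp

theorem determines_alpha {i : Fin 3} {x : Fin 18 → F} (hx : x ∈ H ω (S18 ω) i) :
    Determines (S18 ω) (group x) (alpha ω i) := by
  intro t ht t' ht' h
  have := alpha_eq_zero_of_mem_H hF ω hω hx (sub_mem ht ht') fun j hj => by simp [h j hj]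
  rw [alpha, Pi.sub_apply, sub_mul, tr_sub hF, sub_eq_zero] at this
  exact this

theorem determines_id {i j : Fin 3} (hij : i ≠ j) {x y : Fin 18 → F}
    (hx : x ∈ H ω (S18 ω) i) (hy : y ∈ H ω (S18 ω) j) :
    Determines (S18 ω) (group x ∪ group y) id := by
  intro t ht t' ht' h
  have hd := sub_mem ht ht'
  have hi := alpha_eq_zero_of_mem_H hF ω hω hx hd fun k hk => by
    simp [h k (Finset.mem_union_left _ hk)]
  have hj := alpha_eq_zero_of_mem_H hF ω hω hy hd fun k hk => by
    simp [h k (Finset.mem_union_right _ hk)]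
  exact sub_eq_zero.1 (eq_zero_of_alpha hF hω hij hi hj)

/-- If `x` c-covers `y`, then `y` and `x - y` have disjoint supports inside that of `x`. Were both
nonzero, `x` would have weight at least $8+8=16$, while a group of size at most $13$ means weight at
most $14$. -/
theorem eq_of_cCovered {i : Fin 3} {x y : Fin 18 → F} (hx : x ∈ H ω (S18 ω) i)
    (hy : y ∈ H ω (S18 ω) i) (hcard : #(group x) ≤ 13) (hyx : CCovered y x) : y = x := by
  by_contra hne
  have hxm := ((mem_H_S18 hF ω hω i x).1 hx).1
  have hym := ((mem_H_S18 hF ω hω i y).1 hy).1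
  have h0 := ne_zero_of_mem_H hF ω hω hy
  have h1 := le_hammingNorm_of_mem_S18 hF ω hω (sub_mem hxm hym) (sub_ne_zero.2 (Ne.symm hne))
  have h2 := le_hammingNorm_of_mem_S18 hF ω hω hym (by rintro rfl; exact h0 rfl)
  have h3 := card_group_add_one (ne_zero_of_mem_H hF ω hω hx)
  have h4 : hammingNorm (x - y) + hammingNorm y ≤ hammingNorm x := by
    rw [hammingNorm, hammingNorm, hammingNorm, ← Finset.card_union_of_disjoint]
    · refine Finset.card_le_card fun j hj => ?_
      simp only [Finset.mem_union, Finset.mem_filter, Finset.mem_univ, true_and,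
        Pi.sub_apply] at hj ⊢
      by_cases hyj : y j = 0
      · simpa [hyj] using hj
      · rwa [← hyx j hyj]
    · rw [Finset.disjoint_left]
      intro j hj hj'
      simp only [Finset.mem_filter, Finset.mem_univ, true_and, Pi.sub_apply] at hj hj'
      exact hj (sub_eq_zero.2 (hyx j hj').symm)
  omega

theorem mem_minimalAccessStructure {i j : Fin 3} (hij : i ≠ j) {x y : Fin 18 → F}
    (hx : x ∈ H ω (S18 ω) i) (hy : y ∈ H ω (S18 ω) j)
    (hxc : #(group x) ≤ 13) (hyc : #(group y) ≤ 13) :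
    (x, y) ∈ minimalAccessStructure ω (S18 ω) :=
  ⟨i, j, hij, hx, hy, fun _ hz h => eq_of_cCovered hF ω hω hx hz hxc h,
    fun _ hz h => eq_of_cCovered hF ω hω hy hz hyc h⟩

/-- Together with the dealer, `A` has at most $7$ coordinates, so some codeword vanishes on `A` and
has secret `s`; on `A` it cannot be told apart from the zero word. -/
theorem not_determines {A : Finset (Fin 18)} (h0 : 0 ∉ A) (hA : #A < 7) {f : F → F} {s : F}
    (hf : f s ≠ f 0) : ¬ Determines (S18 ω) A f := by
  intro h
  obtain ⟨c, hc, hcA⟩ := exists_mem_eq_on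
    (Submodule.span F (Set.range (S18Matrix ω (ω ^ 2)).row))
    (lt_hammingNorm_of_orthogonal hF ω hω) (insert 0 A)
    (by rw [Finset.card_insert_of_notMem h0]; omega) (fun i => if (i : Fin 18) = 0 then s else 0)
  have hc0 : c 0 = s := by simpa using hcA ⟨0, Finset.mem_insert_self _ _⟩
  have := h c hc 0 (zero_mem _) fun j hj => by
    have hj0 : j ≠ 0 := fun h => h0 (h ▸ hj)
    simpa [hj0] using hcA ⟨j, Finset.mem_insert_of_mem hj⟩
  rw [hc0] at this
  exact hf this

end Scheme

end AdditiveSSS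

/-! ### The theorem -/

theorem mainTheorem8 {F : Type*} [Field F] [Fintype F] [DecidableEq F]
    (hF : Fintype.card F = 4) (ω : F) (hω : ω ^ 2 + ω + 1 = 0) :
    -- `S_18` is an extremal even additive self-dual `(18, 2 ^ 18)` code, its minimum weight is `8`
    (Nat.card (AdditiveSSS.S18 ω) = 2 ^ 18 ∧
      AdditiveSSS.IsExtremalEvenSelfDual (AdditiveSSS.S18 ω) ∧
      AdditiveSSS.HasMinWeight (AdditiveSSS.S18 ω) 8 ∧
      ∀ k : Fin 6, AdditiveSSS.weightCount (AdditiveSSS.S18 ω) (8 + 2 * k) =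
        (![2754, 18360, 77112, 110160, 50949, 2808] : Fin 6 → ℕ) k) ∧
    -- the numbers `μ` and `μ_i`
    (∀ k : Fin 6, ∀ e : Fin 18 → F, hammingNorm e = 1 →
      AdditiveSSS.mu (AdditiveSSS.S18 ω) (8 + 2 * k) e =
        (![408, 3400, 17136, 28560, 15096, 936] : Fin 6 → ℕ) k) ∧
    (∀ i : Fin 3, ∀ k : Fin 6,
      AdditiveSSS.muI ω (AdditiveSSS.S18 ω) i (8 + 2 * k)
          (Pi.single 0 (AdditiveSSS.scal ω i)) =
        (![408, 3400, 17136, 28560, 15096, 936] : Fin 6 → ℕ) k) ∧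
    -- the size distribution, for each `Γ_{H_i} × Γ_{H_j}` with `i ≠ j` and for `Γ`
    (∀ i j : Fin 3, i ≠ j → AdditiveSSS.HasS18Sizes
      (AdditiveSSS.GammaH ω (AdditiveSSS.S18 ω) i ×ˢ
        AdditiveSSS.GammaH ω (AdditiveSSS.S18 ω) j)) ∧
    AdditiveSSS.HasS18Sizes (AdditiveSSS.Gamma ω (AdditiveSSS.S18 ω)) ∧
    -- the pairs of groups recover the secret in two steps
    (∀ i j : Fin 3, i ≠ j → ∀ x ∈ AdditiveSSS.H ω (AdditiveSSS.S18 ω) i,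
      ∀ y ∈ AdditiveSSS.H ω (AdditiveSSS.S18 ω) j,
      AdditiveSSS.Determines (AdditiveSSS.S18 ω) (AdditiveSSS.group x)
        (AdditiveSSS.alpha ω i) ∧
      AdditiveSSS.Determines (AdditiveSSS.S18 ω) (AdditiveSSS.group y)
        (AdditiveSSS.alpha ω j) ∧
      AdditiveSSS.Determines (AdditiveSSS.S18 ω)
        (AdditiveSSS.group x ∪ AdditiveSSS.group y) id) ∧
    -- the pairs of groups with sizes in `{7, 9, 11, 13}` are minimal
    (∀ i j : Fin 3, i ≠ j → ∀ x ∈ AdditiveSSS.H ω (AdditiveSSS.S18 ω) i,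
      ∀ y ∈ AdditiveSSS.H ω (AdditiveSSS.S18 ω) j,
      (AdditiveSSS.group x).card ∈ ({7, 9, 11, 13} : Finset ℕ) →
      (AdditiveSSS.group y).card ∈ ({7, 9, 11, 13} : Finset ℕ) →
      (x, y) ∈ AdditiveSSS.minimalAccessStructure ω (AdditiveSSS.S18 ω)) ∧
    -- no group of size less than `7` can be used in recovering the secret
    (∀ s ∈ AdditiveSSS.Gamma ω (AdditiveSSS.S18 ω), 7 ≤ s.1.card ∧ 7 ≤ s.2.card) ∧
    (∀ A : Finset (Fin 18), 0 ∉ A → A.card < 7 →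
      (∀ i : Fin 3,
        ¬ AdditiveSSS.Determines (AdditiveSSS.S18 ω) A (AdditiveSSS.alpha ω i)) ∧
      ¬ AdditiveSSS.Determines (AdditiveSSS.S18 ω) A id) ∧
    -- the accessibility degree, for each `Γ_{H_i} × Γ_{H_j}` with `i ≠ j` and for `Γ`
    (∀ i j : Fin 3, i ≠ j → AdditiveSSS.accessibilityDegree
      (AdditiveSSS.GammaH ω (AdditiveSSS.S18 ω) i ×ˢ
        AdditiveSSS.GammaH ω (AdditiveSSS.S18 ω) j) = 1 / 4) ∧
    AdditiveSSS.accessibilityDegree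
      (AdditiveSSS.Gamma ω (AdditiveSSS.S18 ω)) = 1 / 4 := by
  open AdditiveSSS in
  refine ⟨⟨card_S18 hF ω hω, ⟨S18_selfDual hF ω hω, S18_even hF ω hω, hasMinWeight_S18 hF ω hω⟩,
      hasMinWeight_S18 hF ω hω, weightCount_S18 hF ω hω⟩,
    mu_S18 hF ω hω, muI_S18 hF ω hω, fun i j _ => hasS18Sizes_product hF ω hω i j, ?_,
    fun i j hij x hx y hy => ⟨determines_alpha hF ω hω hx, determines_alpha hF ω hω hy,
      determines_id hF ω hω hij hx hy⟩,
    fun i j hij x hx y hy hxc hyc => mem_minimalAccessStructure hF ω hω hij hx hy ?_ ?_,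
    fun s hs => ?_,
    fun A h0 hA => ⟨fun i => not_determines hF ω hω h0 hA (alpha_ne hF hω i),
      not_determines hF ω hω h0 hA (s := 1) one_ne_zero⟩,
    fun i j _ => accessibilityDegree_product hF ω hω i j, ?_⟩
  · rw [Gamma_eq hF ω hω]
    exact hasS18Sizes_product hF ω hω 0 0
  · simp only [Finset.mem_insert, Finset.mem_singleton] at hxc
    omega
  · simp only [Finset.mem_insert, Finset.mem_singleton] at hyc
    omega
  · rw [Gamma_eq hF ω hω] at hs
    obtain ⟨k, l, hk, hl⟩ := (hasS18Sizes_product hF ω hω 0 0).2 s hs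
    omega
  · rw [Gamma_eq hF ω hω]
    exact accessibilityDegree_product hF ω hω 0 0
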